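/- **Proposition 3.13.** Let $\mathcal H$ be a separable infinite-dimensional complex Hilbert space with an orthonormal basis $\mathcal B=(e_n)_{n\in\mathbb N}$, let $S$ be a selfadjoint trace-class operator on $\mathcal H$, and let $\mathbf b=(b_n)_{n\in\mathbb N}$ be a real sequence in $\ell^1(\mathbb N)$. For $k\in\mathbb N$ put $$U_k(S)=\sup_P \operatorname{tr}(SP),\quad L_k(S)=\inf_P \operatorname{tr}(SP),\qquad U_k(\mathbf b)=\sup_{|F|=k}\sum_{i\in F}b_i,\quad L_k(\mathbf b)=\inf_{|F|=k}\sum_{i\in F}b_i,$$ where $P$ ranges over the orthogonal projections of $\mathcal H$ onto $k$-dimensional subspaces and $F$ over the $k$-element subsets of $\mathbb N$. Let $$\mathcal C[\mathcal U_{\mathcal H}(S)]=\bigl\{(\langle U^*SU e_n,e_n\rangle)_{n\in\mathbb N} : U \text{ a unitary operator on } \mathcal H\bigr\}\subseteq \ell^1(\mathbb N).$$ Then the following are equivalent: 1. $\mathbf b$ belongs to the closure of $\mathcal C[\mathcal U_{\mathcal H}(S)]$ in the norm of $\ell^1(\mathbb N)$; 2. $U_k(S)\ge U_k(\mathbf b)$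 and $L_k(S)\le L_k(\mathbf b)$ for every $k\in\mathbb N$, and $\sum_{n} b_n=\operatorname{tr} S$. -/

import Mathlib

open scoped ENNReal

namespace SchurHorn

noncomputable section

variable {H : Type*} [NormedAddCommGroup H] [InnerProductSpace ℂ H] [CompleteSpace H]

/-- A bounded operator `T` is of trace class if `∑ i, ⟨|T| e i, e i⟩ < ∞` for an orthonormal basis
`e` of `H`, where `|T| = (T* T)^(1/2)`. As `|T| ≥ 0`, it does not matter which basis is used. -/
def IsTraceClass (T : H →L[ℂ] H) : Prop :=
  ∃ (w : Set H) (e : HilbertBasis w ℂ H),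
    Summable fun i => (inner ℂ (e i) (CFC.abs T (e i))).re

/-- The index set of some orthonormal basis of `H`. -/
def basisIndex (H : Type*) [NormedAddCommGroup H] [InnerProductSpace ℂ H] [CompleteSpace H] :
    Set H :=
  (exists_hilbertBasis ℂ H).choose

/-- Some orthonormal basis of `H`. -/
def someBasis (H : Type*) [NormedAddCommGroup H] [InnerProductSpace ℂ H] [CompleteSpace H] :
    HilbertBasis (basisIndex H) ℂ H :=
  (exists_hilbertBasis ℂ H).choose_spec.choose

/-- The trace `∑ i, ⟨T e i, e i⟩` of an operator. For `T` of trace class (in particular for `T` of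
finite rank) the sum converges absolutely and does not depend on the orthonormal basis. -/
def trace (T : H →L[ℂ] H) : ℂ :=
  ∑' i, inner ℂ (someBasis H i) (T (someBasis H i))

/-- The set of orthogonal projections of `H` onto subspaces of dimension `k`. -/
def projections (H : Type*) [NormedAddCommGroup H] [InnerProductSpace ℂ H] [CompleteSpace H]
    (k : ℕ) : Set (H →L[ℂ] H) :=
  {P | IsStarProjection P ∧ LinearMap.rank (P : H →ₗ[ℂ] H) = k}

/-- `U_k(S) = sup tr(SP)` over the orthogonal projections `P` of rank `k`, for `S` selfadjoint
(the traces are then real, and at most `k ‖S‖` in absolute value). -/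
def opU (k : ℕ) (S : H →L[ℂ] H) : ℝ :=
  sSup ((fun P => (trace (S * P)).re) '' projections H k)

/-- `L_k(S) = inf tr(SP)` over the orthogonal projections `P` of rank `k`, for `S` selfadjoint. -/
def opL (k : ℕ) (S : H →L[ℂ] H) : ℝ :=
  sInf ((fun P => (trace (S * P)).re) '' projections H k)

/-- `U_k(a) = sup ∑ i ∈ F, a i` over the sets `F` of `k` indices, for a bounded real sequence. -/
def seqU (k : ℕ) (a : ℕ → ℝ) : ℝ :=
  sSup ((fun F : Finset ℕ => ∑ i ∈ F, a i) '' {F | F.card = k})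

/-- `L_k(a) = inf ∑ i ∈ F, a i` over the sets `F` of `k` indices, for a bounded real sequence. -/
def seqL (k : ℕ) (a : ℕ → ℝ) : ℝ :=
  sInf ((fun F : Finset ℕ => ∑ i ∈ F, a i) '' {F | F.card = k})

/-- The unitary orbit `{U* S U : U unitary}` of `S`. -/
def unitaryOrbit (S : H →L[ℂ] H) : Set (H →L[ℂ] H) :=
  {T | ∃ U ∈ unitary (H →L[ℂ] H), T = star U * S * U}

/-- The diagonal `(⟨T e n, e n⟩)` of `T` in the orthonormal basis `B = (e n)`. -/
def diagonal (B : HilbertBasis ℕ ℂ H) (T : H →L[ℂ] H) : ℕ → ℂ :=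
  fun n => inner ℂ (B n) (T (B n))

/-- The set of the diagonals, in the basis `B`, of the operators in the unitary orbit of `S`. -/
def orbitDiagonals (B : HilbertBasis ℕ ℂ H) (S : H →L[ℂ] H) : Set (ℕ → ℂ) :=
  diagonal B '' unitaryOrbit S

/-- The sequences in `ℓ¹` (with its norm) that are diagonals of operators in the unitary orbit of
`S`. If `S` is of trace class, then so is its whole orbit, and every diagonal lies in `ℓ¹`. -/
def orbitDiagonalsL1 (B : HilbertBasis ℕ ℂ H) (S : H →L[ℂ] H) :
    Set (lp (fun _ : ℕ => ℂ) 1) :=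
  {c | (c : ℕ → ℂ) ∈ orbitDiagonals B S}

end

end SchurHorn

/-! A selfadjoint trace-class `S` is compact, so it has an orthonormal basis of eigenvectors with
summable real eigenvalues `a` (`exists_diagonalizes`). The diagonals of its orbit are its diagonals
in all orthonormal bases (`mem_orbitDiagonals_iff`), and a sum of `k` diagonal entries is `tr(SP)`
for a projection `P` of rank `k` (`Diagonalizes.exists_projection`). Such sums, and the total sum,
are continuous on ℓ¹, so the inequalities and the trace identity pass to the closure.

For the converse, `U_k(S)` and `L_k(S)` are never computed. All that is used is `U_k(S) ≤ k t + ∑ (a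
i - t)⁺` for `t ≥ 0` and its mirror image (`Diagonalizes.opU_le`, `Diagonalizes.le_opL`). Applied to
the index set where `b` exceeds `t`, the hypothesis becomes `∑ (b i - t)⁺ ≤ ∑ (a i - t)⁺`, and
likewise for `-b` and `-a`. After the tails are cut off and replaced by three small entries, this is
a finite majorization, so finitely many permutations and averagings of pairs lead from the modified
`a` to the truncated `b`.

The modified `a` need not be a diagonal of `S`. But these operations do not increase ℓ¹ distances,
and the diagonals of `S` are stable under them, by rotation of two basis vectors
(`isMixingClosed_realDiagonals`). Performed on `a` itself, they give a diagonal that is as near to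
the truncated `b` as `a` is to its modification (`IsMixingClosed.exists_near`). -/

namespace SchurHorn

/-! ### Finite majorization by averaging of pairs -/

/-- A set of real sequences that is stable under permutations and under the averaging of two
entries. -/
structure IsMixingClosed (C : Set (ℕ → ℝ)) : Prop where
  perm : ∀ c ∈ C, ∀ σ : Equiv.Perm ℕ, c ∘ σ ∈ C
  transfer : ∀ c ∈ C, ∀ i j : ℕ, ∀ s : ℝ, 0 ≤ s → s ≤ 1 →
    (fun n => (1 - s) * c n + s * c (Equiv.swap i j n)) ∈ C

/-- Elements of `C` near `y` can be replaced by elements of `C` that are as near to `b`, for the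
`ℓ¹` distance. -/
def Follows (C : Set (ℕ → ℝ)) (y b : ℕ → ℝ) : Prop :=
  ∀ c ∈ C, ∃ c' ∈ C, ∑' n, ‖c' n - b n‖ₑ ≤ ∑' n, ‖c n - y n‖ₑ

theorem Follows.refl (C : Set (ℕ → ℝ)) (y : ℕ → ℝ) : Follows C y y :=
  fun c hc => ⟨c, hc, le_rfl⟩

theorem Follows.trans {C : Set (ℕ → ℝ)} {x y z : ℕ → ℝ} (h : Follows C x y)
    (h' : Follows C y z) : Follows C x z := by
  intro c hc
  obtain ⟨c', hc', h1⟩ := h c hc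
  obtain ⟨c'', hc'', h2⟩ := h' c' hc'
  exact ⟨c'', hc'', h2.trans h1⟩

theorem IsMixingClosed.follows_perm {C : Set (ℕ → ℝ)} (hC : IsMixingClosed C) (y : ℕ → ℝ)
    (σ : Equiv.Perm ℕ) : Follows C y (y ∘ σ) := by
  intro c hc
  refine ⟨c ∘ σ, hC.perm c hc σ, le_of_eq ?_⟩
  exact σ.tsum_eq (fun n => ‖c n - y n‖ₑ)

/-- The averaging is a convex combination of the identity and a permutation, hence an ℓ¹
contraction; the same averaging is applied to `c` as to `y`. -/
theorem IsMixingClosed.follows_transfer {C : Set (ℕ → ℝ)} (hC : IsMixingClosed C) (y : ℕ → ℝ)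
    (i j : ℕ) {s : ℝ} (h0 : 0 ≤ s) (h1 : s ≤ 1) :
    Follows C y (fun n => (1 - s) * y n + s * y (Equiv.swap i j n)) := by
  intro c hc
  refine ⟨_, hC.transfer c hc i j s h0 h1, ?_⟩
  calc ∑' n, ‖(1 - s) * c n + s * c (Equiv.swap i j n)
          - ((1 - s) * y n + s * y (Equiv.swap i j n))‖ₑ
      ≤ ∑' n, (‖1 - s‖ₑ * ‖c n - y n‖ₑ
          + ‖s‖ₑ * ‖c (Equiv.swap i j n) - y (Equiv.swap i j n)‖ₑ) := by
        refine ENNReal.tsum_le_tsum fun n => ?_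
        rw [← enorm_mul, ← enorm_mul]
        refine le_trans (le_of_eq ?_) (enorm_add_le _ _)
        congr 1
        ring
    _ = (‖1 - s‖ₑ + ‖s‖ₑ) * ∑' n, ‖c n - y n‖ₑ := by
        rw [ENNReal.tsum_add, ENNReal.tsum_mul_left, ENNReal.tsum_mul_left, add_mul,
          (Equiv.swap i j).tsum_eq (fun n => ‖c n - y n‖ₑ)]
    _ = ∑' n, ‖c n - y n‖ₑ := by
        rw [Real.enorm_of_nonneg h0, Real.enorm_of_nonneg (by linarith),
          ← ENNReal.ofReal_add (by linarith) h0]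
        simp

/-- The Hardy–Littlewood–Pólya theorem: a decreasing finite sequence that is dominated by `y` in the
sense of majorization is obtained from `y` by averaging pairs of entries. -/
theorem IsMixingClosed.follows_of_prefix_sum_le {C : Set (ℕ → ℝ)} (hC : IsMixingClosed C) (M : ℕ)
    (b : ℕ → ℝ) (hb : ∀ i j, i ≤ j → j < M → b j ≤ b i) (y : ℕ → ℝ)
    (hle : ∀ m ≤ M, ∑ i ∈ Finset.range m, b i ≤ ∑ i ∈ Finset.range m, y i)
    (heq : ∑ i ∈ Finset.range M, b i = ∑ i ∈ Finset.range M, y i)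
    (hout : ∀ n, M ≤ n → y n = b n) : Follows C y b := by
  induction hN : ((Finset.range M).filter fun n => y n ≠ b n).card using Nat.strong_induction_on
    generalizing y with
  | _ N ih =>
  by_cases hk : ∃ k, k < M ∧ y k < b k
  swap
  · push Not at hk
    have h := (Finset.sum_eq_sum_iff_of_le
      (fun i hi => hk i (Finset.mem_range.1 hi))).1 heq
    have : y = b := by
      funext n
      rcases lt_or_ge n M with h1 | h1
      · exact (h n (Finset.mem_range.2 h1)).symm
      · exact hout n h1
    rw [this]
    exact Follows.refl C b
  classical
  -- `k` is the first index with a deficit. The prefix sum up to and including `k` then forces a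
  -- surplus at some `j < k`.
  obtain ⟨hkM, hyk⟩ := Nat.find_spec hk
  have hmin : ∀ i, i < Nat.find hk → b i ≤ y i := by
    intro i hi
    have := Nat.find_min hk hi
    push Not at this
    exact this (hi.trans hkM)
  generalize Nat.find hk = k at hkM hyk hmin
  have hj : ∃ j, j < k ∧ b j < y j := by
    by_contra! hcon
    have h1 := hle (k + 1) hkM
    rw [Finset.sum_range_succ, Finset.sum_range_succ] at h1
    have h2 : ∑ i ∈ Finset.range k, y i ≤ ∑ i ∈ Finset.range k, b i :=
      Finset.sum_le_sum fun i hi => hcon i (Finset.mem_range.1 hi)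
    linarith
  obtain ⟨j, hjk, hyj⟩ := hj
  -- The largest amount that can be moved from `j` to `k` without overshooting either target: one of
  -- the two entries becomes correct, so the number of disagreements drops.
  set δ := min (y j - b j) (b k - y k) with hδ
  have hδ0 : 0 < δ := lt_min (by linarith) (by linarith)
  have hδj : δ ≤ y j - b j := min_le_left _ _
  have hδk : δ ≤ b k - y k := min_le_right _ _
  have hbjk := hb j k hjk.le hkM
  have hgap : 0 < y j - y k := by linarith
  set s := δ / (y j - y k) with hs
  have hs0 : 0 ≤ s := by positivity
  have hs1 : s ≤ 1 := by rw [hs, div_le_one hgap]; linarith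
  have hsδ : s * (y j - y k) = δ := div_mul_cancel₀ _ hgap.ne'
  set y' : ℕ → ℝ := fun n => (1 - s) * y n + s * y (Equiv.swap j k n) with hy'
  have hform : ∀ n, y' n = y n - (if n = j then δ else 0) + (if n = k then δ else 0) := by
    intro n
    by_cases h1 : n = j
    · subst h1
      simp only [hy', Equiv.swap_apply_left, if_true, if_neg hjk.ne]
      linarith
    · by_cases h2 : n = k
      · subst h2
        simp only [hy', Equiv.swap_apply_right, if_true, if_neg h1]
        linarith
      · simp only [hy', Equiv.swap_apply_of_ne_of_ne h1 h2, if_neg h1, if_neg h2]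
        ring
  have hsum : ∀ m, ∑ i ∈ Finset.range m, y' i = ∑ i ∈ Finset.range m, y i
      - (if j < m then δ else 0) + (if k < m then δ else 0) := by
    intro m
    simp only [hform, Finset.sum_add_distrib, Finset.sum_sub_distrib, Finset.sum_ite_eq',
      Finset.mem_range]
  refine (hC.follows_transfer y j k hs0 hs1).trans (ih _ ?_ y' ?_ ?_ ?_ rfl)
  · rw [← hN]
    refine Finset.card_lt_card (Finset.ssubset_iff_of_subset ?_ |>.2 ?_)
    · intro n hn
      simp only [Finset.mem_filter, Finset.mem_range] at hn ⊢
      refine ⟨hn.1, fun h => hn.2 ?_⟩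
      have h1 : n ≠ j := by rintro rfl; linarith
      have h2 : n ≠ k := by rintro rfl; linarith
      rw [hform, if_neg h1, if_neg h2, h]
      ring
    · rcases le_total (y j - b j) (b k - y k) with h | h
      · refine ⟨j, ?_, ?_⟩
        · simp only [Finset.mem_filter, Finset.mem_range]
          exact ⟨hjk.trans hkM, hyj.ne'⟩
        · simp only [Finset.mem_filter, not_and, not_not]
          intro _
          rw [hform, if_pos rfl, if_neg hjk.ne, hδ, min_eq_left h]
          ring
      · refine ⟨k, ?_, ?_⟩
        · simp only [Finset.mem_filter, Finset.mem_range]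
          exact ⟨hkM, hyk.ne⟩
        · simp only [Finset.mem_filter, not_and, not_not]
          intro _
          rw [hform, if_pos rfl, if_neg hjk.ne', hδ, min_eq_right h]
          ring
  · intro m hm
    rw [hsum]
    by_cases h1 : k < m
    · rw [if_pos h1, if_pos (hjk.trans h1)]
      linarith [hle m hm]
    · rw [if_neg h1]
      by_cases h2 : j < m
      · rw [if_pos h2]
        -- For `j < m ≤ k` there is no deficit among the first `m` entries, so the surplus at `j`
        -- alone pays for the loss of `δ`.
        have h3 : y j - b j ≤ ∑ i ∈ Finset.range m, (y i - b i) :=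
          Finset.single_le_sum (f := fun i => y i - b i)
            (fun i hi => sub_nonneg.2 (hmin i (by have := Finset.mem_range.1 hi; omega)))
            (Finset.mem_range.2 h2)
        rw [Finset.sum_sub_distrib] at h3
        linarith
      · rw [if_neg h2]
        linarith [hle m hm]
  · rw [hsum, if_pos hkM, if_pos (hjk.trans hkM), heq]
    ring
  · intro n hn
    rw [hform, if_neg (by omega), if_neg (by omega), hout n hn]
    ring

/-- Every sequence can be sorted decreasingly on an initial segment. -/
theorem exists_perm_sorting (M : ℕ) (y : ℕ → ℝ) :
    ∃ σ : Equiv.Perm ℕ, (∀ n, M ≤ n → σ n = n) ∧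
      ∀ i j, i ≤ j → j < M → y (σ j) ≤ y (σ i) := by
  set τ := Tuple.sort (fun i : Fin M => -y i)
  have hτ : Monotone ((fun i : Fin M => -y i) ∘ τ) := Tuple.monotone_sort _
  have himg : ∀ i (hi : i < M), τ.extendDomain Fin.equivSubtype i = τ ⟨i, hi⟩ := fun i hi =>
    Equiv.Perm.extendDomain_apply_image τ Fin.equivSubtype ⟨i, hi⟩
  refine ⟨τ.extendDomain Fin.equivSubtype, fun n hn => ?_, fun i j hij hj => ?_⟩
  · exact Equiv.Perm.extendDomain_apply_not_subtype _ _ (by omega)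
  · rw [himg i (by omega), himg j hj]
    have := hτ (show (⟨i, by omega⟩ : Fin M) ≤ ⟨j, hj⟩ from hij)
    simpa using this

theorem sum_range_comp_perm {M : ℕ} {σ : Equiv.Perm ℕ} (hσ : ∀ n, M ≤ n → σ n = n)
    (f : ℕ → ℝ) : ∑ i ∈ Finset.range M, f (σ i) = ∑ i ∈ Finset.range M, f i := by
  refine Equiv.Perm.sum_comp σ _ f fun n hn => ?_
  by_contra h
  exact hn (hσ n (by simpa using h))

/-- For finitely supported sequences, domination of the sums of the positive parts `(x - t)⁺` is
enough for averaging. -/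
theorem IsMixingClosed.follows_of_posPart_sum_le {C : Set (ℕ → ℝ)} (hC : IsMixingClosed C) (M : ℕ)
    (b y : ℕ → ℝ) (hb : ∀ n, M ≤ n → b n = 0) (hy : ∀ n, M ≤ n → y n = 0)
    (hle : ∀ t : ℝ, ∑ i ∈ Finset.range M, max (b i - t) 0 ≤ ∑ i ∈ Finset.range M, max (y i - t) 0)
    (heq : ∑ i ∈ Finset.range M, b i = ∑ i ∈ Finset.range M, y i) : Follows C y b := by
  obtain ⟨σ, hσ, hσy⟩ := exists_perm_sorting M y
  obtain ⟨τ, hτ, hτb⟩ := exists_perm_sorting M b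
  have hmid : Follows C (y ∘ σ) (b ∘ τ) := by
    refine hC.follows_of_prefix_sum_le M _ hτb _ ?_ ?_ ?_
    · intro m hm
      rcases hm.eq_or_lt with rfl | hm
      · simp only [Function.comp_apply, sum_range_comp_perm hσ, sum_range_comp_perm hτ, heq, le_refl]
      -- At this threshold the positive parts of the sorted `y` reduce exactly to its first `m`
      -- entries.
      set t := y (σ m) with ht
      have h1 := hle t
      rw [← sum_range_comp_perm hσ (fun i => max (y i - t) 0),
        ← sum_range_comp_perm hτ (fun i => max (b i - t) 0)] at h1
      have h2 : ∑ i ∈ Finset.range M, max (y (σ i) - t) 0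
          = ∑ i ∈ Finset.range m, (y (σ i) - t) := by
        rw [← Finset.sum_range_add_sum_Ico _ hm.le, Finset.sum_eq_zero (s := Finset.Ico m M),
          add_zero]
        · refine Finset.sum_congr rfl fun i hi => max_eq_left ?_
          have := hσy i m (Finset.mem_range.1 hi).le hm
          linarith
        · intro i hi
          have := hσy m i (Finset.mem_Ico.1 hi).1 (Finset.mem_Ico.1 hi).2
          exact max_eq_right (by linarith)
      have h3 : ∑ i ∈ Finset.range m, (b (τ i) - t)
          ≤ ∑ i ∈ Finset.range M, max (b (τ i) - t) 0 :=
        (Finset.sum_le_sum fun i _ => le_max_left _ _).trans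
          (Finset.sum_le_sum_of_subset_of_nonneg (Finset.range_subset_range.2 hm.le)
            fun i _ _ => le_max_right _ _)
      rw [Finset.sum_sub_distrib] at h2 h3
      simp only [Function.comp_apply]
      linarith
    · simp only [Function.comp_apply, sum_range_comp_perm hσ, sum_range_comp_perm hτ, heq]
    · intro n hn
      simp only [Function.comp_apply, hσ n hn, hτ n hn, hb n hn, hy n hn]
  have hback : Follows C (b ∘ τ) b := by
    have := hC.follows_perm (b ∘ τ) τ⁻¹
    have h : (b ∘ τ) ∘ ⇑τ⁻¹ = b := by
      funext n
      simp
    rwa [h] at this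
  exact ((hC.follows_perm y σ).trans hmid).trans hback

/-! ### Truncation of summable sequences and ℓ¹ approximation -/

/-- If some entry exceeds `t`, it suffices to subtract `t` from that entry alone, the others being
nonnegative; if none does, every positive part vanishes. -/
theorem tsum_max_sub_le {a : ℕ → ℝ} (ha : Summable a) (h0 : ∀ n, 0 ≤ a n) {t : ℝ} (ht : 0 ≤ t) :
    ∑' n, max (a n - t) 0 ≤ max (∑' n, a n - t) 0 := by
  have hs : Summable fun n => max (a n - t) 0 :=
    ha.of_nonneg_of_le (fun n => le_max_right _ _) fun n => max_le (by linarith) (h0 n)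
  by_cases h : ∃ m, t < a m
  · obtain ⟨m, hm⟩ := h
    refine le_trans ?_ (le_max_left _ _)
    have h1 : HasSum (fun n => a n - if n = m then t else 0) (∑' n, a n - t) :=
      ha.hasSum.sub (hasSum_ite_eq m t)
    rw [← h1.tsum_eq]
    refine hs.tsum_le_tsum (fun n => ?_) h1.summable
    by_cases hn : n = m
    · subst hn
      rw [if_pos rfl]
      exact max_le le_rfl (by linarith)
    · rw [if_neg hn]
      exact max_le (by linarith) (by linarith [h0 n])
  · push Not at h
    refine le_trans (le_of_eq ?_) (le_max_right _ _)
    have h1 : ∀ n, max (a n - t) 0 = 0 := fun n => max_eq_right (sub_nonpos.2 (h n))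
    simp only [h1, tsum_zero]

theorem summable_max_sub {a : ℕ → ℝ} (ha : Summable a) {t : ℝ} (ht : 0 ≤ t) :
    Summable fun n => max (a n - t) 0 :=
  ha.abs.of_nonneg_of_le (fun n => le_max_right _ _)
    fun n => max_le (by linarith [le_abs_self (a n)]) (abs_nonneg _)

theorem summable_max_zero {a : ℕ → ℝ} (ha : Summable a) : Summable fun n => max (a n) 0 := by
  simpa using summable_max_sub ha le_rfl

/-- The positive part of a tail may be collapsed to a single entry. -/
theorem tsum_max_sub_le_sum_add {a : ℕ → ℝ} (ha : Summable a) (N : ℕ) {t : ℝ} (ht : 0 ≤ t) :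
    ∑' n, max (a n - t) 0
      ≤ ∑ n ∈ Finset.range N, max (a n - t) 0 + max (∑' n, max (a (n + N)) 0 - t) 0 := by
  rw [← (summable_max_sub ha ht).sum_add_tsum_nat_add N]
  gcongr
  refine le_trans (le_of_eq (tsum_congr fun n => ?_)) (tsum_max_sub_le
    (summable_max_zero ((summable_nat_add_iff N).2 ha)) (fun n => le_max_right _ _) ht)
  rcases le_total (a (n + N)) 0 with h | h
  · rw [max_eq_right h, max_eq_right, max_eq_right] <;> linarith
  · rw [max_eq_left h]

theorem exists_tail_le (a : ℕ → ℝ) {ε : ℝ} (hε : 0 < ε) :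
    ∃ N₀, ∀ N ≥ N₀, ∑' n, |a (n + N)| ≤ ε := by
  have h := tendsto_sum_nat_add fun n => |a n|
  exact Filter.eventually_atTop.1 (h.eventually (ge_mem_nhds hε))

/-- `ℓ¹` sequences majorized by an element of `C` are in the closure of `C`. -/
theorem IsMixingClosed.exists_near {C : Set (ℕ → ℝ)} (hC : IsMixingClosed C) {a b : ℕ → ℝ}
    (haC : a ∈ C) (ha : Summable a) (hb : Summable b)
    (hU : ∀ N, ∀ t : ℝ, 0 ≤ t →
      ∑ i ∈ Finset.range N, max (b i - t) 0 ≤ ∑' n, max (a n - t) 0)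
    (hL : ∀ N, ∀ t : ℝ, 0 ≤ t →
      ∑ i ∈ Finset.range N, max (-b i - t) 0 ≤ ∑' n, max (-a n - t) 0)
    (heq : ∑' n, b n = ∑' n, a n) {ε : ℝ} (hε : 0 < ε) :
    ∃ c ∈ C, ∑' n, ‖c n - b n‖ₑ ≤ ENNReal.ofReal ε := by
  -- Five errors are added: the tail of `b`, the tail of `a`, and the three extra entries `p`, `-q`,
  -- `-D`.
  obtain ⟨N₁, hN₁⟩ := exists_tail_le a (show 0 < ε / 5 by positivity)
  obtain ⟨N₂, hN₂⟩ := exists_tail_le b (show 0 < ε / 5 by positivity)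
  set N := max N₁ N₂
  have hta := hN₁ N (le_max_left _ _)
  have htb := hN₂ N (le_max_right _ _)
  have hsa : Summable fun n => a (n + N) := (summable_nat_add_iff N).2 ha
  have hsb : Summable fun n => b (n + N) := (summable_nat_add_iff N).2 hb
  set p := ∑' n, max (a (n + N)) 0 with hp
  set q := ∑' n, max (-a (n + N)) 0 with hq
  set D := ∑' n, b (n + N) with hD
  have hp0 : 0 ≤ p := tsum_nonneg fun n => le_max_right _ _
  have hq0 : 0 ≤ q := tsum_nonneg fun n => le_max_right _ _
  have hpε : p ≤ ε / 5 := ((summable_max_zero hsa).tsum_le_tsum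
    (fun n => max_le (le_abs_self _) (abs_nonneg _)) hsa.abs).trans hta
  have hqε : q ≤ ε / 5 := ((summable_max_zero hsa.neg).tsum_le_tsum
    (fun n => max_le (neg_le_abs _) (abs_nonneg _)) hsa.abs).trans hta
  have hDε : |D| ≤ ε / 5 := by
    refine le_trans ?_ htb
    simpa [Real.norm_eq_abs] using norm_tsum_le_tsum_norm (f := fun n => b (n + N)) hsb.norm
  have hpq : p - q = ∑' n, a (n + N) := by
    rw [hp, hq, ← (summable_max_zero hsa).tsum_sub (summable_max_zero hsa.neg)]
    refine tsum_congr fun n => ?_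
    rcases le_total (a (n + N)) 0 with h | h
    · rw [max_eq_right h, max_eq_left] <;> linarith
    · rw [max_eq_left h, max_eq_right] <;> linarith
  -- The positive and negative parts of the tail of `a` are each collapsed to one entry. The entry
  -- `-D` makes up for the lost tail of `b`, so that `b'` and `y` have equal sums; it can only
  -- increase the positive-part sums of `y`.
  set b' : ℕ → ℝ := fun n => if n < N then b n else 0 with hb'
  set y : ℕ → ℝ := fun n => if n < N then a n else if n = N then p else if n = N + 1 then -q else
    if n = N + 2 then -D else 0 with hy
  have hsum3 : ∀ f : ℕ → ℝ, ∑ i ∈ Finset.range (N + 3), f i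
      = ∑ i ∈ Finset.range N, f i + f N + f (N + 1) + f (N + 2) := fun f => by
    rw [Finset.sum_range_succ, Finset.sum_range_succ, Finset.sum_range_succ]
  have hyN : y N = p := by simp [hy]
  have hyN1 : y (N + 1) = -q := by simp [hy]
  have hyN2 : y (N + 2) = -D := by simp [hy]
  have hylt : ∀ i ∈ Finset.range N, y i = a i := fun i hi => by
    simp [hy, Finset.mem_range.1 hi]
  have hblt : ∀ i ∈ Finset.range N, b' i = b i := fun i hi => by
    simp [hb', Finset.mem_range.1 hi]
  have hbge : ∀ n, N ≤ n → b' n = 0 := fun n hn => by simp [hb', hn]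
  have hyge : ∀ n, N + 3 ≤ n → y n = 0 := fun n hn => by
    simp only [hy]
    rw [if_neg (by omega), if_neg (by omega), if_neg (by omega), if_neg (by omega)]
  clear_value b' y p q D
  have hyg : ∀ g : ℝ → ℝ, ∑ i ∈ Finset.range N, g (y i) = ∑ i ∈ Finset.range N, g (a i) :=
    fun g => Finset.sum_congr rfl fun i hi => by rw [hylt i hi]
  have hbg : ∀ g : ℝ → ℝ, ∑ i ∈ Finset.range N, g (b' i) = ∑ i ∈ Finset.range N, g (b i) :=
    fun g => Finset.sum_congr rfl fun i hi => by rw [hblt i hi]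
  have hsumeq : ∑ i ∈ Finset.range (N + 3), b' i = ∑ i ∈ Finset.range (N + 3), y i := by
    rw [hsum3, hsum3, hyN, hyN1, hyN2, hbge N le_rfl, hbge (N + 1) (by omega),
      hbge (N + 2) (by omega), Finset.sum_congr rfl hylt, Finset.sum_congr rfl hblt]
    have h1 := ha.sum_add_tsum_nat_add N
    have h2 := hb.sum_add_tsum_nat_add N
    linarith
  have hplus : ∀ t : ℝ, 0 ≤ t → ∑ i ∈ Finset.range (N + 3), max (b' i - t) 0
      ≤ ∑ i ∈ Finset.range (N + 3), max (y i - t) 0 := by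
    intro t ht
    rw [hsum3, hsum3, hyN, hyN1, hyN2, hbge N le_rfl, hbge (N + 1) (by omega),
      hbge (N + 2) (by omega), max_eq_right (by linarith : 0 - t ≤ 0),
      hyg fun x => max (x - t) 0, hbg fun x => max (x - t) 0]
    have h1 := (hU N t ht).trans (tsum_max_sub_le_sum_add ha N ht)
    rw [← hp] at h1
    linarith [le_max_right (-q - t) 0, le_max_right (-D - t) 0]
  have hminus : ∀ t : ℝ, 0 ≤ t → ∑ i ∈ Finset.range (N + 3), max (-b' i - t) 0
      ≤ ∑ i ∈ Finset.range (N + 3), max (-y i - t) 0 := by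
    intro t ht
    rw [hsum3, hsum3, hyN, hyN1, hyN2, hbge N le_rfl, hbge (N + 1) (by omega),
      hbge (N + 2) (by omega), max_eq_right (by linarith : -0 - t ≤ 0),
      hyg fun x => max (-x - t) 0, hbg fun x => max (-x - t) 0, neg_neg q]
    have h1 := (hL N t ht).trans (tsum_max_sub_le_sum_add ha.neg N ht)
    rw [← hq] at h1
    linarith [le_max_right (-p - t) 0, le_max_right (- -D - t) 0]
  have hfol : Follows C y b' := by
    refine hC.follows_of_posPart_sum_le (N + 3) b' y (fun n hn => hbge n (by omega))
      hyge (fun t => ?_) hsumeq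
    rcases le_total 0 t with ht | ht
    · exact hplus t ht
    -- Since the total sums agree, thresholds `t ≤ 0` reduce to the inequality for `-b'`, `-y` at
    -- `-t ≥ 0`.
    · have key : ∀ x : ℝ, max (x - t) 0 = (x - t) + max (-x - -t) 0 := fun x => by
        rcases le_total x t with h | h
        · rw [max_eq_right, max_eq_left] <;> linarith
        · rw [max_eq_left, max_eq_right] <;> linarith
      simp only [key, Finset.sum_add_distrib, Finset.sum_sub_distrib]
      have := hminus (-t) (by linarith)
      linarith
  obtain ⟨c, hc, hcle⟩ := hfol a haC
  refine ⟨c, hc, ?_⟩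
  have hbb : ∑' n, ‖b' n - b n‖ₑ ≤ ENNReal.ofReal (ε / 5) := by
    rw [← ENNReal.summable.sum_add_tsum_nat_add' (k := N), Finset.sum_eq_zero, zero_add]
    · refine le_trans (le_of_eq ?_) (ENNReal.ofReal_le_ofReal htb)
      rw [ENNReal.ofReal_tsum_of_nonneg (fun n => abs_nonneg _) hsb.abs]
      refine tsum_congr fun n => ?_
      rw [hbge _ (by omega), zero_sub, enorm_neg, Real.enorm_eq_ofReal_abs]
    · intro i hi
      rw [hblt i hi, sub_self, enorm_zero]
  have hay : ∑' n, ‖a n - y n‖ₑ ≤ ENNReal.ofReal (4 * (ε / 5)) := by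
    set e : ℕ → ℝ := fun n => |a (n + N)| + (if n = 0 then p else 0) + (if n = 1 then q else 0)
      + (if n = 2 then |D| else 0) with he
    have hes : HasSum e (∑' n, |a (n + N)| + p + q + |D|) :=
      ((hsa.abs.hasSum.add (hasSum_ite_eq 0 p)).add (hasSum_ite_eq 1 q)).add
        (hasSum_ite_eq 2 |D|)
    have he0 : ∀ n, 0 ≤ e n := fun n => by
      simp only [he]
      positivity
    rw [← ENNReal.summable.sum_add_tsum_nat_add' (k := N), Finset.sum_eq_zero, zero_add]
    · have hle : ∑' n, e n ≤ 4 * (ε / 5) := by rw [hes.tsum_eq]; linarith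
      refine le_trans ?_ (ENNReal.ofReal_le_ofReal hle)
      rw [ENNReal.ofReal_tsum_of_nonneg he0 hes.summable]
      refine ENNReal.tsum_le_tsum fun n => ?_
      rw [Real.enorm_eq_ofReal_abs]
      refine ENNReal.ofReal_le_ofReal ((abs_sub _ _).trans ?_)
      simp only [he, add_assoc]
      gcongr
      match n with
      | 0 => simp [hyN, abs_of_nonneg hp0]
      | 1 => simp [add_comm 1 N, hyN1, abs_of_nonneg hq0]
      | 2 => simp [add_comm 2 N, hyN2]
      | n + 3 => simp [hyge (n + 3 + N) (by omega)]
    · intro i hi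
      rw [hylt i hi, sub_self, enorm_zero]
  calc ∑' n, ‖c n - b n‖ₑ ≤ ∑' n, (‖c n - b' n‖ₑ + ‖b' n - b n‖ₑ) := by
        refine ENNReal.tsum_le_tsum fun n => ?_
        refine le_trans (le_of_eq ?_) (enorm_add_le _ _)
        congr 1
        ring
    _ ≤ ENNReal.ofReal (4 * (ε / 5)) + ENNReal.ofReal (ε / 5) := by
        rw [ENNReal.tsum_add]
        exact add_le_add (hcle.trans hay) hbb
    _ = ENNReal.ofReal ε := by
        rw [← ENNReal.ofReal_add (by positivity) (by positivity)]
        congr 1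
        ring

/-! ### Hilbert bases, trace class and diagonalization -/

variable {H : Type*} [NormedAddCommGroup H] [InnerProductSpace ℂ H]

theorem hasSum_norm_inner_sq {ι : Type*} (e : HilbertBasis ι ℂ H) (x : H) :
    HasSum (fun i => ‖inner ℂ (e i) x‖ ^ 2) (‖x‖ ^ 2) := by
  have h := Complex.hasSum_re (e.hasSum_inner_mul_inner x x)
  have h1 : (inner ℂ x x).re = ‖x‖ ^ 2 := by
    rw [inner_self_eq_norm_sq_to_K]
    norm_cast
  rw [h1] at h
  refine h.congr_fun fun i => ?_
  rw [← inner_conj_symm x (e i), ← Complex.normSq_eq_conj_mul_self, Complex.ofReal_re,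
    Complex.normSq_eq_norm_sq]

theorem tsum_enorm_inner_sq {ι : Type*} (e : HilbertBasis ι ℂ H) (x : H) :
    ∑' i, ‖inner ℂ (e i) x‖ₑ ^ 2 = ‖x‖ₑ ^ 2 := by
  have h := hasSum_norm_inner_sq e x
  rw [← ofReal_norm x, ← ENNReal.ofReal_pow (norm_nonneg _), ← h.tsum_eq,
    ENNReal.ofReal_tsum_of_nonneg (fun i => by positivity) h.summable]
  refine tsum_congr fun i => ?_
  rw [ENNReal.ofReal_pow (norm_nonneg _), ofReal_norm]

/-- `f` is a Hilbert basis of eigenvectors of `S`, with summable real eigenvalues `a`. -/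
structure Diagonalizes (f : HilbertBasis ℕ ℂ H) (a : ℕ → ℝ) (S : H →L[ℂ] H) : Prop where
  summable : Summable a
  apply_eq : ∀ n, S (f n) = (a n : ℂ) • f n

theorem Diagonalizes.inner_apply {f : HilbertBasis ℕ ℂ H} {a : ℕ → ℝ} {S : H →L[ℂ] H}
    (hf : Diagonalizes f a S) (n : ℕ) : inner ℂ (f n) (S (f n)) = (a n : ℂ) := by
  rw [hf.apply_eq, inner_smul_right, inner_self_eq_norm_sq_to_K, f.orthonormal.1]
  simp

/-- Each `B n` has only countably many nonzero coefficients, and a vector of `e` orthogonal to every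
`B n` would vanish. -/
theorem countable_of_hilbertBasis {ι : Type*} (B : HilbertBasis ℕ ℂ H) (e : HilbertBasis ι ℂ H) :
    Countable ι := by
  have h1 : ∀ n, (Function.support fun i => ‖inner ℂ (e i) (B n)‖ ^ 2).Countable := fun n =>
    (hasSum_norm_inner_sq e (B n)).summable.countable_support
  rw [← Set.countable_univ_iff]
  refine (Set.countable_iUnion h1).mono fun i _ => ?_
  by_contra hcon
  simp only [Set.mem_iUnion, Function.mem_support, not_exists, not_not] at hcon
  have h2 := (hasSum_norm_inner_sq B (e i)).tsum_eq
  have h3 : ∀ n, ‖inner ℂ (B n) (e i)‖ ^ 2 = 0 := fun n => by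
    rw [← hcon n, ← inner_conj_symm, RCLike.norm_conj]
  simp [h3, e.orthonormal.1 i] at h2

variable [CompleteSpace H]

/-- Parseval in both bases and an exchange of sums. Working in `ℝ≥0∞` avoids any summability
hypothesis, and the equality shows that finiteness of the Hilbert–Schmidt norm does not depend on
the basis. -/
theorem tsum_enorm_sq_eq_adjoint {ι κ : Type*} (e : HilbertBasis ι ℂ H) (f : HilbertBasis κ ℂ H)
    (A : H →L[ℂ] H) : ∑' i, ‖A (e i)‖ₑ ^ 2 = ∑' j, ‖A.adjoint (f j)‖ₑ ^ 2 := by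
  simp_rw [← tsum_enorm_inner_sq f (A _), ← tsum_enorm_inner_sq e (A.adjoint _)]
  rw [ENNReal.tsum_comm]
  refine tsum_congr fun j => tsum_congr fun i => ?_
  rw [ContinuousLinearMap.adjoint_inner_right, ← inner_conj_symm, RCLike.enorm_conj]

theorem summable_norm_sq_iff {ι E : Type*} [NormedAddCommGroup E] (u : ι → E) :
    Summable (fun i => ‖u i‖ ^ 2) ↔ ∑' i, ‖u i‖ₑ ^ 2 ≠ ⊤ := by
  have h : ∀ i, ‖u i‖ₑ ^ 2 = ENNReal.ofReal (‖u i‖ ^ 2) := fun i => by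
    rw [ENNReal.ofReal_pow (norm_nonneg _), ofReal_norm]
  simp_rw [h]
  constructor
  · exact fun hs => hs.tsum_ofReal_ne_top
  · intro hs
    have := ENNReal.summable_toReal hs
    refine this.congr fun i => ENNReal.toReal_ofReal (by positivity)

theorem norm_le_sqrt_tsum {ι : Type*} (e : HilbertBasis ι ℂ H) (A : H →L[ℂ] H)
    (hA : Summable fun i => ‖A (e i)‖ ^ 2) : ‖A‖ ≤ √(∑' i, ‖A (e i)‖ ^ 2) := by
  rw [← ContinuousLinearMap.adjoint.norm_map A]
  refine ContinuousLinearMap.opNorm_le_bound _ (Real.sqrt_nonneg _) fun y => ?_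
  refine Real.le_sqrt_of_sq_le ?_ |>.trans_eq ?_ (b := √((∑' i, ‖A (e i)‖ ^ 2) * ‖y‖ ^ 2))
  · rw [← (hasSum_norm_inner_sq e _).tsum_eq, ← tsum_mul_right]
    refine (hasSum_norm_inner_sq e _).summable.tsum_le_tsum (fun i => ?_) (hA.mul_right _)
    rw [ContinuousLinearMap.adjoint_inner_right, ← mul_pow]
    gcongr
    exact norm_inner_le_norm _ _
  · rw [Real.sqrt_mul (tsum_nonneg fun i => by positivity), Real.sqrt_sq (norm_nonneg _)]

/-- A Hilbert–Schmidt operator is the norm limit of its finite-rank truncations: the operator norm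
of the remainder is at most its Hilbert–Schmidt norm, the root of a tail of the series. -/
theorem isCompactOperator_of_summable {ι : Type*} (e : HilbertBasis ι ℂ H) (A : H →L[ℂ] H)
    (hA : Summable fun i => ‖A (e i)‖ ^ 2) : IsCompactOperator A := by
  classical
  set F : Finset ι → H →L[ℂ] H := fun s => ∑ i ∈ s, InnerProductSpace.rankOne ℂ (A (e i)) (e i)
    with hF
  have hFe : ∀ s i, (A - F s) (e i) = if i ∈ s then 0 else A (e i) := by
    intro s i
    simp only [hF, sub_apply, sum_apply,
      InnerProductSpace.rankOne_apply, orthonormal_iff_ite.1 e.orthonormal, ite_smul, one_smul,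
      zero_smul, Finset.sum_ite_eq']
    split_ifs <;> simp
  have hsq : ∀ s i, ‖(A - F s) (e i)‖ ^ 2
      = Set.indicator {j | j ∉ s} (fun j => ‖A (e j)‖ ^ 2) i := by
    intro s i
    rw [hFe, Set.indicator_apply]
    by_cases h : i ∈ s <;> simp [h]
  have hnorm : ∀ s, ‖F s - A‖ ≤ √(∑' i : {j // j ∉ s}, ‖A (e i)‖ ^ 2) := by
    intro s
    rw [norm_sub_rev]
    refine (norm_le_sqrt_tsum e (A - F s) ?_).trans (le_of_eq ?_)
    · simp_rw [hsq]
      exact hA.indicator _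
    · simp_rw [hsq]
      rw [← tsum_subtype {j | j ∉ s} (fun j => ‖A (e j)‖ ^ 2)]
      rfl
  have hlim : Filter.Tendsto F Filter.atTop (nhds A) := by
    rw [tendsto_iff_norm_sub_tendsto_zero]
    refine squeeze_zero (fun s => norm_nonneg _) hnorm ?_
    have h := (tendsto_tsum_compl_atTop_zero fun i => ‖A (e i)‖ ^ 2).sqrt
    rwa [Real.sqrt_zero] at h
  refine isCompactOperator_of_tendsto hlim (Filter.Eventually.of_forall fun s => ?_)
  have : F s ∈ compactOperator (RingHom.id ℂ) H H := by
    refine Submodule.sum_mem _ fun i _ => ?_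
    have h : IsCompactOperator (innerSL ℂ (e i)) :=
      isCompactOperator_of_locallyCompactSpace_dom _
    exact h.clm_comp
      (ContinuousLinearMap.toSpanSingleton ℂ (A (e i)))
  exact this

/-- Translates the diagonal of a positive operator into the Hilbert–Schmidt sum of its square root.
-/
theorem norm_sqrt_apply_sq {T : H →L[ℂ] H} (hT : 0 ≤ T) (x : H) :
    ‖CFC.sqrt T x‖ ^ 2 = (inner ℂ x (T x)).re := by
  have h1 : IsSelfAdjoint (CFC.sqrt T) := (CFC.sqrt_nonneg T).isSelfAdjoint
  have h2 : T x = CFC.sqrt T (CFC.sqrt T x) := by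
    conv_lhs => rw [← CFC.sqrt_mul_sqrt_self T hT]
    rfl
  rw [h2, ← ContinuousLinearMap.adjoint_inner_left, ← ContinuousLinearMap.star_eq_adjoint,
    h1.star_eq, inner_self_eq_norm_sq_to_K]
  norm_cast

theorem re_inner_nonneg {T : H →L[ℂ] H} (hT : 0 ≤ T) (x : H) : 0 ≤ (inner ℂ x (T x)).re := by
  rw [← norm_sqrt_apply_sq hT]
  positivity

theorem isCompactOperator_of_nonneg {ι : Type*} (e : HilbertBasis ι ℂ H) {T : H →L[ℂ] H}
    (hT : 0 ≤ T) (h : Summable fun i => (inner ℂ (e i) (T (e i))).re) : IsCompactOperator T := by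
  simp_rw [← norm_sqrt_apply_sq hT] at h
  have h1 := (isCompactOperator_of_summable e _ h).clm_comp (CFC.sqrt T)
  rw [← CFC.sqrt_mul_sqrt_self T hT]
  exact h1

theorem summable_of_nonneg {ι κ : Type*} (e : HilbertBasis ι ℂ H) (f : HilbertBasis κ ℂ H)
    {T : H →L[ℂ] H} (hT : 0 ≤ T) (h : Summable fun i => (inner ℂ (e i) (T (e i))).re) :
    Summable fun i => (inner ℂ (f i) (T (f i))).re := by
  have h1 : IsSelfAdjoint (CFC.sqrt T) := (CFC.sqrt_nonneg T).isSelfAdjoint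
  simp_rw [← norm_sqrt_apply_sq hT] at h ⊢
  rw [summable_norm_sq_iff] at h ⊢
  rwa [tsum_enorm_sq_eq_adjoint f e, ← ContinuousLinearMap.star_eq_adjoint, h1.star_eq]

/-- Take the positive and negative parts of `S`: both are positive with sum `|S|`, so their
diagonals are dominated by that of `|S|`. -/
theorem exists_nonneg_decomposition {S : H →L[ℂ] H} (hS : IsSelfAdjoint S)
    (hS1 : IsTraceClass S) : ∃ T R : H →L[ℂ] H, 0 ≤ T ∧ 0 ≤ R ∧ S = T - R ∧
      ∃ (w : Set H) (e : HilbertBasis w ℂ H), (Summable fun i => (inner ℂ (e i) (T (e i))).re) ∧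
        Summable fun i => (inner ℂ (e i) (R (e i))).re := by
  obtain ⟨w, e, he⟩ := hS1
  refine ⟨S⁺, S⁻, CFC.posPart_nonneg S, CFC.negPart_nonneg S, (CFC.posPart_sub_negPart S hS).symm,
    w, e, ?_, ?_⟩ <;>
  · refine he.of_nonneg_of_le (fun i => re_inner_nonneg (by cfc_tac) _) fun i => ?_
    have h1 := re_inner_nonneg (CFC.posPart_nonneg S) (e i)
    have h2 := re_inner_nonneg (CFC.negPart_nonneg S) (e i)
    rw [← CFC.posPart_add_negPart S hS, add_apply, inner_add_right,
      Complex.add_re]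
    linarith

theorem IsTraceClass.summable_re_inner {ι : Type*} {S : H →L[ℂ] H} (hS : IsSelfAdjoint S)
    (hS1 : IsTraceClass S) (f : HilbertBasis ι ℂ H) :
    Summable fun i => (inner ℂ (f i) (S (f i))).re := by
  obtain ⟨T, R, hT, hR, rfl, w, e, h1, h2⟩ := exists_nonneg_decomposition hS hS1
  simpa [inner_sub_right] using (summable_of_nonneg e f hT h1).sub (summable_of_nonneg e f hR h2)

theorem IsTraceClass.isCompactOperator {S : H →L[ℂ] H} (hS : IsSelfAdjoint S)
    (hS1 : IsTraceClass S) : IsCompactOperator S := by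
  obtain ⟨T, R, hT, hR, rfl, w, e, h1, h2⟩ := exists_nonneg_decomposition hS hS1
  exact (isCompactOperator_of_nonneg e hT h1).sub (isCompactOperator_of_nonneg e hR h2)

/-- The Hilbert–Schmidt sum of the identity counts the vectors of a basis, and it is the same for
`B` and `e`. -/
theorem infinite_of_hilbertBasis {ι : Type*} (B : HilbertBasis ℕ ℂ H) (e : HilbertBasis ι ℂ H) :
    Infinite ι := by
  by_contra hfin
  rw [not_infinite_iff_finite] at hfin
  have := Fintype.ofFinite ι
  have h := tsum_enorm_sq_eq_adjoint B e (ContinuousLinearMap.id ℂ H)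
  rw [← ContinuousLinearMap.star_eq_adjoint] at h
  have hid : star (ContinuousLinearMap.id ℂ H) = ContinuousLinearMap.id ℂ H := star_one _
  have hB : ∀ n, ‖B n‖ₑ = 1 := fun n => by rw [← ofReal_norm, B.orthonormal.1 n, ENNReal.ofReal_one]
  have he : ∀ n, ‖e n‖ₑ = 1 := fun n => by rw [← ofReal_norm, e.orthonormal.1 n, ENNReal.ofReal_one]
  simp only [hid, ContinuousLinearMap.id_apply, hB, he, one_pow, tsum_fintype, ENNReal.tsum_const,
    Finset.sum_const, nsmul_eq_mul, mul_one] at h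
  rw [ENat.card_eq_top_of_infinite] at h
  simp at h

/-- In an infinite-dimensional separable space every Hilbert basis can be indexed by `ℕ`. -/
theorem exists_reindex {ι : Type*} (B : HilbertBasis ℕ ℂ H) (e : HilbertBasis ι ℂ H) :
    ∃ (f : HilbertBasis ℕ ℂ H) (σ : ℕ ≃ ι), ∀ n, f n = e (σ n) := by
  have := countable_of_hilbertBasis B e
  have := infinite_of_hilbertBasis B e
  obtain ⟨σ⟩ := nonempty_equiv_of_countable (α := ℕ) (β := ι)
  have hv : Orthonormal ℂ (e ∘ σ) := e.orthonormal.comp σ σ.injective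
  have hsp : ⊤ ≤ (Submodule.span ℂ (Set.range (e ∘ σ))).topologicalClosure := by
    rw [σ.surjective.range_comp, e.dense_span]
  exact ⟨HilbertBasis.mk hv hsp, σ, fun n => by rw [HilbertBasis.coe_mk]; rfl⟩

/-- The spectral theorem for compact selfadjoint operators: there is a Hilbert basis of
eigenvectors. -/
theorem exists_hilbertBasis_eigenvectors.{u} {H : Type u} [NormedAddCommGroup H]
    [InnerProductSpace ℂ H] [CompleteSpace H] {S : H →L[ℂ] H} (hS : IsSelfAdjoint S)
    (hc : IsCompactOperator S) : ∃ (ι : Type u) (e : HilbertBasis ι ℂ H) (μ : ι → ℂ),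
      ∀ i, S (e i) = μ i • e i := by
  have hsymm : (S : H →ₗ[ℂ] H).IsSymmetric := hS.isSymmetric
  set V : ℂ → Submodule ℂ H := fun μ => Module.End.eigenspace (S : H →ₗ[ℂ] H) μ with hV
  have hclosed : ∀ μ, IsClosed (V μ : Set H) := by
    intro μ
    have : (V μ : Set H) = {x | S x = μ • x} := by
      ext x
      simp [hV]
    rw [this]
    exact isClosed_eq S.continuous (continuous_const_smul μ)
  have hcomplete : ∀ μ, CompleteSpace (V μ) := fun μ => (hclosed μ).completeSpace_coe
  choose w u hu using fun μ => exists_hilbertBasis ℂ (V μ)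
  set v : (Σ μ, w μ) → H := fun a => (u a.1 a.2 : H) with hv
  have horth : Orthonormal ℂ v :=
    hsymm.orthogonalFamily_eigenspaces.orthonormal_sigma_orthonormal fun μ => (u μ).orthonormal
  have hbot : (Submodule.span ℂ (Set.range v))ᗮ = ⊥ := by
    rw [eq_bot_iff, ← ContinuousLinearMap.orthogonalComplement_iSup_eigenspaces_eq_bot hc hsymm]
    intro x hx
    rw [Submodule.mem_orthogonal'] at hx ⊢
    have hmem : (⨆ μ, Module.End.eigenspace (S : H →ₗ[ℂ] H) μ) ≤ (ℂ ∙ x)ᗮ := by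
      refine iSup_le fun μ y hy => ?_
      rw [Submodule.mem_orthogonal_singleton_iff_inner_right]
      -- Expand `y` in the basis of its eigenspace and pair with `x`: every term is zero.
      have h1 := ((u μ).hasSum_repr ⟨y, hy⟩).mapL ((innerSL ℂ x).comp (V μ).subtypeL)
      refine h1.unique ?_
      convert hasSum_zero using 2 with i
      have h2 := hx (v ⟨μ, i⟩) (Submodule.subset_span ⟨_, rfl⟩)
      simp only [hv] at h2
      simp [h2]
    intro y hy
    exact Submodule.mem_orthogonal_singleton_iff_inner_right.1 (hmem hy)
  refine ⟨_, HilbertBasis.mkOfOrthogonalEqBot horth hbot, fun a => a.1, fun a => ?_⟩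
  rw [HilbertBasis.coe_mkOfOrthogonalEqBot]
  exact Module.End.mem_eigenspace_iff.1 (u a.1 a.2).2

theorem exists_diagonalizes (B : HilbertBasis ℕ ℂ H) {S : H →L[ℂ] H} (hS : IsSelfAdjoint S)
    (hS1 : IsTraceClass S) : ∃ f a, Diagonalizes f a S := by
  obtain ⟨ι, e, μ, he⟩ := exists_hilbertBasis_eigenvectors hS (hS1.isCompactOperator hS)
  obtain ⟨f, σ, hf⟩ := exists_reindex B e
  have hμ : ∀ n, inner ℂ (f n) (S (f n)) = μ (σ n) := fun n => by
    rw [hf, he, inner_smul_right, inner_self_eq_norm_sq_to_K, e.orthonormal.1]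
    simp
  -- Defining the eigenvalues as diagonal entries of `S` makes their summability an instance of
  -- `IsTraceClass.summable_re_inner`.
  refine ⟨f, fun n => (inner ℂ (f n) (S (f n))).re, hS1.summable_re_inner hS f, fun n => ?_⟩
  have hreal : (((inner ℂ (f n) (S (f n))).re : ℝ) : ℂ) = inner ℂ (f n) (S (f n)) := by
    rw [← Complex.conj_eq_iff_re, inner_conj_symm]
    exact hS.isSymmetric _ _
  rw [hreal, hμ, hf, he]

/-! ### Traces against projections and variational bounds -/

/-- The trace of `S P` can be computed in every basis, and in a basis of eigenvectors of `S`. -/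
theorem Diagonalizes.exists_hasSum {f : HilbertBasis ℕ ℂ H} {a : ℕ → ℝ} {S : H →L[ℂ] H}
    (hf : Diagonalizes f a S) (hS : IsSelfAdjoint S) {ι : Type*} (g : HilbertBasis ι ℂ H)
    (P : H →L[ℂ] H) : HasSum (fun j => inner ℂ (g j) (S (P (g j))))
      (∑' i, (a i : ℂ) * inner ℂ (f i) (P (f i))) := by
  -- Both sides are iterated sums of one double series; the remaining task is its absolute
  -- convergence.
  set F : ℕ × ι → ℂ := fun x =>
    (a x.1 : ℂ) * (inner ℂ (g x.2) (f x.1) * inner ℂ (f x.1) (P (g x.2))) with hF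
  have hrow : ∀ i, HasSum (fun j => F (i, j)) ((a i : ℂ) * inner ℂ (f i) (P (f i))) := by
    intro i
    refine HasSum.mul_left _ ?_
    have h := g.hasSum_inner_mul_inner (P.adjoint (f i)) (f i)
    rw [ContinuousLinearMap.adjoint_inner_left] at h
    refine h.congr_fun fun j => ?_
    rw [ContinuousLinearMap.adjoint_inner_left, mul_comm]
  have hcol : ∀ j, HasSum (fun i => F (i, j)) (inner ℂ (g j) (S (P (g j)))) := by
    intro j
    refine (f.hasSum_inner_mul_inner (g j) (S (P (g j)))).congr_fun fun i => ?_
    have h : inner ℂ (f i) (S (P (g j))) = (a i : ℂ) * inner ℂ (f i) (P (g j)) := by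
      rw [← hS.isSymmetric.apply_clm, hf.apply_eq, inner_smul_left, Complex.conj_ofReal]
    rw [h]
    simp only [hF]
    ring
  have hFs : Summable F := by
    -- A majorant by the arithmetic–geometric mean inequality; Parseval bounds its sum over `j` by a
    -- constant times `|a i|`.
    set G : ℕ × ι → ℝ := fun x => |a x.1| *
      (‖inner ℂ (g x.2) (f x.1)‖ ^ 2 + ‖inner ℂ (g x.2) (P.adjoint (f x.1))‖ ^ 2) with hG
    have hGrow : ∀ i, HasSum (fun j => G (i, j)) (|a i| * (‖f i‖ ^ 2 + ‖P.adjoint (f i)‖ ^ 2)) :=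
      fun i => ((hasSum_norm_inner_sq g _).add (hasSum_norm_inner_sq g _)).mul_left _
    have hGs : Summable G := by
      rw [summable_prod_of_nonneg fun x => by simp only [hG, Pi.zero_apply]; positivity]
      refine ⟨fun i => (hGrow i).summable, ?_⟩
      simp_rw [fun i => (hGrow i).tsum_eq]
      refine (hf.summable.abs.mul_right (1 + ‖P.adjoint‖ ^ 2)).of_nonneg_of_le
        (fun i => by positivity) fun i => ?_
      have h := P.adjoint.le_opNorm (f i)
      rw [f.orthonormal.1, mul_one] at h
      rw [f.orthonormal.1, one_pow]
      gcongr
    refine Summable.of_norm_bounded hGs fun x => ?_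
    simp only [hF, hG, norm_mul, Complex.norm_real, Real.norm_eq_abs]
    rw [← ContinuousLinearMap.adjoint_inner_left, ← inner_conj_symm (P.adjoint _) (g _),
      RCLike.norm_conj]
    gcongr
    nlinarith [sq_nonneg (‖inner ℂ (g x.2) (f x.1)‖ - ‖inner ℂ (g x.2) (P.adjoint (f x.1))‖),
      sq_nonneg (‖inner ℂ (g x.2) (f x.1)‖), sq_nonneg (‖inner ℂ (g x.2) (P.adjoint (f x.1))‖)]
  have h1 := hFs.hasSum.prod_fiberwise hrow
  have h2 := hFs.prod_symm.hasSum.prod_fiberwise hcol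
  rw [h1.tsum_eq]
  rwa [show ∑' x : ι × ℕ, F x.swap = ∑' x, F x from (Equiv.prodComm ι ℕ).tsum_eq F] at h2

theorem Diagonalizes.trace_mul {f : HilbertBasis ℕ ℂ H} {a : ℕ → ℝ} {S : H →L[ℂ] H}
    (hf : Diagonalizes f a S) (hS : IsSelfAdjoint S) (P : H →L[ℂ] H) :
    trace (S * P) = ∑' i, (a i : ℂ) * inner ℂ (f i) (P (f i)) :=
  (hf.exists_hasSum hS (someBasis H) P).tsum_eq

theorem Diagonalizes.hasSum_trace_mul {f : HilbertBasis ℕ ℂ H} {a : ℕ → ℝ} {S : H →L[ℂ] H}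
    (hf : Diagonalizes f a S) (hS : IsSelfAdjoint S) {ι : Type*} (g : HilbertBasis ι ℂ H)
    (P : H →L[ℂ] H) : HasSum (fun j => inner ℂ (g j) (S (P (g j)))) (trace (S * P)) := by
  rw [hf.trace_mul hS]
  exact hf.exists_hasSum hS g P

theorem Diagonalizes.hasSum_trace {f : HilbertBasis ℕ ℂ H} {a : ℕ → ℝ} {S : H →L[ℂ] H}
    (hf : Diagonalizes f a S) (hS : IsSelfAdjoint S) {ι : Type*} (g : HilbertBasis ι ℂ H) :
    HasSum (fun j => inner ℂ (g j) (S (g j))) (trace S) := by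
  simpa using hf.hasSum_trace_mul hS g 1

theorem inner_apply_of_isStarProjection {P : H →L[ℂ] H} (hP : IsStarProjection P) (x : H) :
    inner ℂ x (P x) = ((‖P x‖ ^ 2 : ℝ) : ℂ) := by
  have h1 : P x = P (P x) := by
    conv_lhs => rw [← hP.isIdempotentElem.eq]
    rfl
  rw [h1, ← hP.isSelfAdjoint.isSymmetric.apply_clm, ← h1, inner_self_eq_norm_sq_to_K]
  norm_cast

/-- For an orthonormal basis `v` of the range, `‖P (f i)‖² = ∑ l, |⟨f i, v l⟩|²`; summing over `i`
first gives the squared norms of `k` unit vectors. -/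
theorem hasSum_norm_sq_of_mem_projections {ι : Type*} (f : HilbertBasis ι ℂ H) {k : ℕ}
    {P : H →L[ℂ] H} (hP : P ∈ projections H k) : HasSum (fun i => ‖P (f i)‖ ^ 2) (k : ℝ) := by
  obtain ⟨hP, hrank⟩ := hP
  set V := LinearMap.range (P : H →ₗ[ℂ] H) with hV
  have hfin : Module.Finite ℂ V := by
    rw [← Module.rank_lt_aleph0_iff, hV, ← LinearMap.rank, hrank]
    exact Cardinal.natCast_lt_aleph0
  have hdim : Module.finrank ℂ V = k := Module.finrank_eq_of_rank_eq hrank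
  set v := stdOrthonormalBasis ℂ V
  have h1 : ∀ i, ‖P (f i)‖ ^ 2 = ∑ l, ‖inner ℂ (f i) (v l : H)‖ ^ 2 := by
    intro i
    have h2 := v.sum_sq_norm_inner_right ⟨P (f i), ⟨f i, rfl⟩⟩
    rw [Submodule.coe_norm] at h2
    rw [← h2]
    refine Finset.sum_congr rfl fun l _ => ?_
    obtain ⟨z, hz⟩ := (v l).2
    have h3 : P (v l : H) = v l := by
      rw [← hz]
      exact DFunLike.congr_fun hP.isIdempotentElem.eq z
    rw [Submodule.coe_inner, ← hP.isSelfAdjoint.isSymmetric.apply_clm, h3, ← inner_conj_symm,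
      RCLike.norm_conj]
  simp_rw [h1]
  have h2 := hasSum_sum (s := Finset.univ) fun l _ => hasSum_norm_inner_sq f (v l : H)
  have h3 : ∀ l, ‖(v l : H)‖ ^ 2 = 1 := fun l => by
    rw [← Submodule.coe_norm, v.orthonormal.1, one_pow]
  simpa [h3, hdim] using h2

/-- The variational bound for `∑ aᵢ pᵢ` where `0 ≤ pᵢ ≤ 1` and `∑ pᵢ = k`. -/
theorem le_of_hasSum_weights {a p : ℕ → ℝ} {k T t : ℝ} (ha : Summable a) (ht : 0 ≤ t)
    (h0 : ∀ i, 0 ≤ p i) (h1 : ∀ i, p i ≤ 1) (hp : HasSum p k)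
    (hT : HasSum (fun i => a i * p i) T) : T ≤ k * t + ∑' i, max (a i - t) 0 := by
  refine hasSum_le (fun i => ?_) hT ((hp.mul_right t).add (summable_max_sub ha ht).hasSum)
  have h2 : (a i - t) * p i ≤ max (a i - t) 0 := by
    rcases le_total (a i - t) 0 with h | h
    · exact (mul_nonpos_of_nonpos_of_nonneg h (h0 i)).trans (le_max_right _ _)
    · exact (mul_le_of_le_one_right h (h1 i)).trans (le_max_left _ _)
  linarith

theorem Diagonalizes.hasSum_re_trace {f : HilbertBasis ℕ ℂ H} {a : ℕ → ℝ} {S : H →L[ℂ] H}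
    (hf : Diagonalizes f a S) (hS : IsSelfAdjoint S) {P : H →L[ℂ] H} (hP : IsStarProjection P) :
    HasSum (fun i => a i * ‖P (f i)‖ ^ 2) (trace (S * P)).re := by
  refine (Complex.hasSum_re (hf.hasSum_trace_mul hS f P)).congr_fun fun i => ?_
  rw [← hS.isSymmetric.apply_clm, hf.apply_eq, inner_smul_left, Complex.conj_ofReal,
    inner_apply_of_isStarProjection hP, ← Complex.ofReal_mul, Complex.ofReal_re]

theorem norm_sq_le_one_of_isStarProjection {P : H →L[ℂ] H} (hP : IsStarProjection P) {x : H}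
    (hx : ‖x‖ = 1) : ‖P x‖ ^ 2 ≤ 1 := by
  have h := P.le_of_opNorm_le hP.norm_le x
  rw [hx, one_mul] at h
  exact pow_le_one₀ (norm_nonneg _) h

theorem Diagonalizes.re_trace_le {f : HilbertBasis ℕ ℂ H} {a : ℕ → ℝ} {S : H →L[ℂ] H}
    (hf : Diagonalizes f a S) (hS : IsSelfAdjoint S) {k : ℕ} {P : H →L[ℂ] H}
    (hP : P ∈ projections H k) {t : ℝ} (ht : 0 ≤ t) :
    (trace (S * P)).re ≤ k * t + ∑' i, max (a i - t) 0 :=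
  le_of_hasSum_weights hf.summable ht (fun i => by positivity)
    (fun i => norm_sq_le_one_of_isStarProjection hP.1 (f.orthonormal.1 i))
    (hasSum_norm_sq_of_mem_projections f hP) (hf.hasSum_re_trace hS hP.1)

theorem Diagonalizes.le_re_trace {f : HilbertBasis ℕ ℂ H} {a : ℕ → ℝ} {S : H →L[ℂ] H}
    (hf : Diagonalizes f a S) (hS : IsSelfAdjoint S) {k : ℕ} {P : H →L[ℂ] H}
    (hP : P ∈ projections H k) {t : ℝ} (ht : 0 ≤ t) :
    -(k * t + ∑' i, max (-a i - t) 0) ≤ (trace (S * P)).re := by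
  rw [neg_le]
  refine le_of_hasSum_weights hf.summable.neg ht (fun i => by positivity)
    (fun i => norm_sq_le_one_of_isStarProjection hP.1 (f.orthonormal.1 i))
    (hasSum_norm_sq_of_mem_projections f hP) ?_
  simpa only [neg_mul] using (hf.hasSum_re_trace hS hP.1).neg

theorem Diagonalizes.opU_le {f : HilbertBasis ℕ ℂ H} {a : ℕ → ℝ} {S : H →L[ℂ] H}
    (hf : Diagonalizes f a S) (hS : IsSelfAdjoint S) (k : ℕ) {t : ℝ} (ht : 0 ≤ t) :
    opU k S ≤ k * t + ∑' i, max (a i - t) 0 := by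
  -- Nonnegativity of the bound replaces a proof that rank-`k` projections exist.
  refine Real.sSup_le ?_ (add_nonneg (by positivity) (tsum_nonneg fun i => le_max_right _ _))
  rintro _ ⟨P, hP, rfl⟩
  exact hf.re_trace_le hS hP ht

theorem Diagonalizes.le_opL {f : HilbertBasis ℕ ℂ H} {a : ℕ → ℝ} {S : H →L[ℂ] H}
    (hf : Diagonalizes f a S) (hS : IsSelfAdjoint S) (k : ℕ) {t : ℝ} (ht : 0 ≤ t) :
    -(k * t + ∑' i, max (-a i - t) 0) ≤ opL k S := by
  refine Real.le_sInf ?_ (neg_nonpos.2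
    (add_nonneg (by positivity) (tsum_nonneg fun i => le_max_right _ _)))
  rintro _ ⟨P, hP, rfl⟩
  exact hf.le_re_trace hS hP ht

theorem Diagonalizes.re_trace_le_opU {f : HilbertBasis ℕ ℂ H} {a : ℕ → ℝ} {S : H →L[ℂ] H}
    (hf : Diagonalizes f a S) (hS : IsSelfAdjoint S) {k : ℕ} {P : H →L[ℂ] H}
    (hP : P ∈ projections H k) : (trace (S * P)).re ≤ opU k S := by
  -- The case `t = 0` of the variational bound shows that the set is bounded above.
  refine le_csSup ⟨k * 0 + ∑' i, max (a i - 0) 0, ?_⟩ ⟨P, hP, rfl⟩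
  rintro _ ⟨Q, hQ, rfl⟩
  exact hf.re_trace_le hS hQ le_rfl

theorem Diagonalizes.opL_le_re_trace {f : HilbertBasis ℕ ℂ H} {a : ℕ → ℝ} {S : H →L[ℂ] H}
    (hf : Diagonalizes f a S) (hS : IsSelfAdjoint S) {k : ℕ} {P : H →L[ℂ] H}
    (hP : P ∈ projections H k) : opL k S ≤ (trace (S * P)).re := by
  refine csInf_le ⟨-(k * 0 + ∑' i, max (-a i - 0) 0), ?_⟩ ⟨P, hP, rfl⟩
  rintro _ ⟨Q, hQ, rfl⟩
  exact hf.le_re_trace hS hQ le_rfl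

/-- Every finite partial sum of a diagonal of `S` is the trace of `S P` for a projection `P` of the
corresponding rank. -/
theorem Diagonalizes.exists_projection {f : HilbertBasis ℕ ℂ H} {a : ℕ → ℝ} {S : H →L[ℂ] H}
    (hf : Diagonalizes f a S) (hS : IsSelfAdjoint S) (g : HilbertBasis ℕ ℂ H) (F : Finset ℕ) :
    ∃ P ∈ projections H F.card, trace (S * P) = ∑ i ∈ F, inner ℂ (g i) (S (g i)) := by
  set v : F → H := fun i => g i with hv
  have hvo : Orthonormal ℂ v := g.orthonormal.comp _ Subtype.val_injective
  set V := Submodule.span ℂ (Set.range v) with hV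
  have hfin : FiniteDimensional ℂ V := FiniteDimensional.span_of_finite ℂ (Set.finite_range v)
  refine ⟨V.starProjection, ⟨isStarProjection_starProjection, ?_⟩, ?_⟩
  · classical
    rw [LinearMap.rank, Submodule.range_starProjection, hV, rank_span hvo.linearIndependent,
      Cardinal.mk_fintype, Set.card_range_of_injective hvo.linearIndependent.injective,
      Fintype.card_coe]
  · have hin : ∀ j ∈ F, V.starProjection (g j) = g j := fun j hj =>
      Submodule.starProjection_eq_self_iff.2 (Submodule.subset_span ⟨⟨j, hj⟩, rfl⟩)
    have hout : ∀ j ∉ F, V.starProjection (g j) = 0 := by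
      intro j hj
      rw [Submodule.starProjection_apply_eq_zero_iff, hV, Submodule.mem_orthogonal']
      intro u hu
      refine Submodule.span_induction (p := fun u _ => inner ℂ (g j) u = 0) ?_ (by simp) ?_ ?_ hu
      · rintro _ ⟨i, rfl⟩
        exact g.orthonormal.2 fun h => hj (h ▸ i.2)
      · intro x y _ _ hx hy
        rw [inner_add_right, hx, hy, add_zero]
      · intro c x _ hx
        rw [inner_smul_right, hx, mul_zero]
    have h1 := hf.hasSum_trace_mul hS g V.starProjection
    refine h1.unique ?_
    have h2 : ∑ j ∈ F, inner ℂ (g j) (S (g j))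
        = ∑ j ∈ F, inner ℂ (g j) (S (V.starProjection (g j))) :=
      Finset.sum_congr rfl fun j hj => by rw [hin j hj]
    rw [h2]
    exact hasSum_sum_of_ne_finset_zero fun j hj => by rw [hout j hj, map_zero, inner_zero_right]

/-! ### Changes of basis and stability of the diagonals -/

/-- The diagonals of operators in the unitary orbit of `S` are the diagonals of `S` itself in
arbitrary bases. -/
theorem mem_orbitDiagonals_iff (B : HilbertBasis ℕ ℂ H) (S : H →L[ℂ] H) (c : ℕ → ℂ) :
    c ∈ orbitDiagonals B S ↔ ∃ g : HilbertBasis ℕ ℂ H, ∀ n, c n = inner ℂ (g n) (S (g n)) := by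
  have key : ∀ (U : H →L[ℂ] H) (x : H),
      inner ℂ x ((star U * S * U) x) = inner ℂ (U x) (S (U x)) := fun U x => by
    rw [← ContinuousLinearMap.adjoint_inner_right]
    rfl
  constructor
  · rintro ⟨_, ⟨U, hU, rfl⟩, rfl⟩
    set V := Unitary.linearIsometryEquiv ⟨U, hU⟩
    refine ⟨HilbertBasis.ofRepr (V.symm.trans B.repr), fun n => ?_⟩
    have h : HilbertBasis.ofRepr (V.symm.trans B.repr) n = U (B n) := by
      rw [← HilbertBasis.repr_symm_single, ← HilbertBasis.repr_symm_single]
      rfl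
    rw [h]
    exact key U (B n)
  · rintro ⟨g, hg⟩
    set V := Unitary.linearIsometryEquiv.symm (B.repr.trans g.repr.symm)
    refine ⟨star (V : H →L[ℂ] H) * S * V, ⟨V, V.2, rfl⟩, ?_⟩
    funext n
    have h : (V : H →L[ℂ] H) (B n) = g n := by
      change g.repr.symm (B.repr (B n)) = g n
      rw [HilbertBasis.repr_self, HilbertBasis.repr_symm_single]
    rw [diagonal, key, h, hg]

/-- Rotation of two vectors of a Hilbert basis. -/
theorem exists_rotated_hilbertBasis (g : HilbertBasis ℕ ℂ H) {i j : ℕ} (hij : i ≠ j) {α : ℝ} {β : ℂ}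
    (hαβ : (α : ℂ) * α + β * (starRingEnd ℂ) β = 1) :
    ∃ g' : HilbertBasis ℕ ℂ H, g' i = (α : ℂ) • g i + β • g j ∧
      g' j = -(starRingEnd ℂ) β • g i + (α : ℂ) • g j ∧ ∀ n, n ≠ i → n ≠ j → g' n = g n := by
  set v : ℕ → H := fun n => if n = i then (α : ℂ) • g i + β • g j else
    if n = j then -(starRingEnd ℂ) β • g i + (α : ℂ) • g j else g n with hv
  have hvi : v i = (α : ℂ) • g i + β • g j := by simp [hv]
  have hvj : v j = -(starRingEnd ℂ) β • g i + (α : ℂ) • g j := by simp [hv, hij.symm]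
  have hvn : ∀ n, n ≠ i → n ≠ j → v n = g n := fun n h1 h2 => by simp [hv, h1, h2]
  clear_value v
  have hg := orthonormal_iff_ite.1 g.orthonormal
  have hne : ∀ m n, m ≠ n → inner ℂ (g m) (g n) = 0 := fun m n h => by rw [hg, if_neg h]
  have hself : ∀ m, inner ℂ (g m) (g m) = 1 := fun m => by rw [hg, if_pos rfl]
  have hij0 := hne i j hij
  have hji0 := hne j i hij.symm
  have hpair : ∀ m n, m < n ∨ n < m → inner ℂ (v m) (v n) = 0 := by
    have hij' : inner ℂ (v i) (v j) = 0 := by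
      simp only [hvi, hvj, inner_add_left, inner_add_right, inner_smul_left, inner_smul_right, hself,
        hij0, hji0, Complex.conj_ofReal]
      ring
    have hji' : inner ℂ (v j) (v i) = 0 := by rw [← inner_conj_symm, hij', map_zero]
    have hin : ∀ n, n ≠ i → n ≠ j → inner ℂ (v i) (v n) = 0 := fun n h1 h2 => by
      simp only [hvi, hvn n h1 h2, inner_add_left, inner_smul_left, hne i n h1.symm,
        hne j n h2.symm, mul_zero, add_zero]
    have hjn : ∀ n, n ≠ i → n ≠ j → inner ℂ (v j) (v n) = 0 := fun n h1 h2 => by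
      simp only [hvj, hvn n h1 h2, inner_add_left, inner_smul_left, hne i n h1.symm,
        hne j n h2.symm, mul_zero, add_zero]
    intro m n hmn
    by_cases h1 : m = i
    · by_cases h2 : n = j
      · rw [h1, h2, hij']
      · rw [h1, hin n (by omega) h2]
    by_cases h2 : m = j
    · by_cases h3 : n = i
      · rw [h2, h3, hji']
      · rw [h2, hjn n h3 (by omega)]
    by_cases h3 : n = i
    · rw [h3, ← inner_conj_symm, hin m h1 h2, map_zero]
    by_cases h4 : n = j
    · rw [h4, ← inner_conj_symm, hjn m h1 h2, map_zero]
    rw [hvn m h1 h2, hvn n h3 h4, hne m n (by omega)]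
  have hunit : ∀ n, inner ℂ (v n) (v n) = 1 := by
    intro n
    by_cases h1 : n = i
    · subst h1
      simp only [hvi, inner_add_left, inner_add_right, inner_smul_left, inner_smul_right, hself,
        hij0, hji0, Complex.conj_ofReal]
      linear_combination hαβ
    by_cases h2 : n = j
    · subst h2
      simp only [hvj, inner_add_left, inner_add_right, inner_smul_left, inner_smul_right, hself,
        hij0, hji0, Complex.conj_ofReal, map_neg, Complex.conj_conj]
      linear_combination hαβ
    rw [hvn n h1 h2, hself]
  have horth : Orthonormal ℂ v := by
    rw [orthonormal_iff_ite]
    intro m n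
    split_ifs with h
    · rw [h, hunit]
    · exact hpair m n (by omega)
  have hbot : (Submodule.span ℂ (Set.range v))ᗮ = ⊥ := by
    rw [eq_bot_iff]
    intro x hx
    rw [Submodule.mem_orthogonal] at hx
    have hx' : ∀ n, inner ℂ (v n) x = 0 := fun n => hx _ (Submodule.subset_span ⟨n, rfl⟩)
    have h1 := hx' i
    have h2 := hx' j
    simp only [hvi, hvj, inner_add_left, inner_smul_left, Complex.conj_ofReal, map_neg,
      Complex.conj_conj] at h1 h2
    have h3 : ∀ n, inner ℂ (g n) x = 0 := by
      intro n
      by_cases hn1 : n = i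
      · subst hn1
        -- The adjoint of the rotation inverts it, recovering the coefficient of `x` at the original
        -- basis vector.
        linear_combination (α : ℂ) * h1 - (starRingEnd ℂ) β * h2 - inner ℂ (g n) x * hαβ
      by_cases hn2 : n = j
      · subst hn2
        linear_combination β * h1 + (α : ℂ) * h2 - inner ℂ (g n) x * hαβ
      rw [← hvn n hn1 hn2, hx']
    have h4 := (hasSum_norm_inner_sq g x).tsum_eq
    simp only [h3, norm_zero, ne_eq, OfNat.ofNat_ne_zero, not_false_eq_true, zero_pow,
      tsum_zero] at h4
    exact norm_eq_zero.1 (pow_eq_zero_iff two_ne_zero |>.1 h4.symm)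
  refine ⟨HilbertBasis.mkOfOrthogonalEqBot horth hbot, ?_⟩
  rw [HilbertBasis.coe_mkOfOrthogonalEqBot]
  exact ⟨hvi, hvj, hvn⟩

/-- There is a complex number of given modulus with which `z` has an imaginary product. -/
theorem exists_mul_add_conj_eq_zero (z : ℂ) {s : ℝ} (hs : 0 ≤ s) :
    ∃ β : ℂ, β * (starRingEnd ℂ) β = s ∧ β * z + (starRingEnd ℂ) (β * z) = 0 := by
  have hsq : ((√s : ℝ) : ℂ) * (√s : ℝ) = s := by rw [← Complex.ofReal_mul, Real.mul_self_sqrt hs]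
  by_cases hz : z = 0
  · exact ⟨(√s : ℝ), by rw [Complex.conj_ofReal, hsq], by simp [hz]⟩
  have hn : ((‖z‖ : ℝ) : ℂ) ≠ 0 := by simpa using hz
  have hzz : z * (starRingEnd ℂ) z = (‖z‖ : ℂ) ^ 2 := Complex.mul_conj' z
  -- This choice gives `β z = i √s ‖z‖`, which is imaginary.
  refine ⟨(√s : ℝ) * Complex.I * ((starRingEnd ℂ) z / ‖z‖), ?_, ?_⟩
  · simp only [map_mul, map_div₀, Complex.conj_ofReal, Complex.conj_I, Complex.conj_conj]
    field_simp
    linear_combination (-Complex.I ^ 2 * z * (starRingEnd ℂ) z) * hsq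
      - Complex.I ^ 2 * s * hzz - s * (‖z‖ : ℂ) ^ 2 * Complex.I_sq
  · simp only [map_mul, map_div₀, Complex.conj_ofReal, Complex.conj_I, Complex.conj_conj]
    ring

/-- The real sequences that are diagonals of `S` in some Hilbert basis. -/
def realDiagonals (S : H →L[ℂ] H) : Set (ℕ → ℝ) :=
  {c | ∃ g : HilbertBasis ℕ ℂ H, ∀ n, (c n : ℂ) = inner ℂ (g n) (S (g n))}

/-- Averaging comes from rotating `g i`, `g j` with squared moduli `1 - s` and `s`. The phase of `β`
is chosen so that the off-diagonal entry of `S` contributes nothing to the new diagonal. -/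
theorem isMixingClosed_realDiagonals {S : H →L[ℂ] H} (hS : IsSelfAdjoint S) :
    IsMixingClosed (realDiagonals S) where
  perm := by
    rintro c ⟨g, hg⟩ σ
    have hsp : ⊤ ≤ (Submodule.span ℂ (Set.range (g ∘ σ))).topologicalClosure := by
      rw [σ.surjective.range_comp, g.dense_span]
    refine ⟨HilbertBasis.mk (g.orthonormal.comp σ σ.injective) hsp, fun n => ?_⟩
    rw [HilbertBasis.coe_mk]
    exact hg (σ n)
  transfer := by
    rintro c ⟨g, hg⟩ i j s h0 h1
    by_cases hij : i = j
    · subst hij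
      refine ⟨g, fun n => ?_⟩
      beta_reduce
      rw [← hg n, Equiv.swap_self, Equiv.refl_apply]
      push_cast
      ring
    obtain ⟨β, hβ, hβz⟩ := exists_mul_add_conj_eq_zero (inner ℂ (g i) (S (g j))) h0
    have hα : ((√(1 - s) : ℝ) : ℂ) * (√(1 - s) : ℝ) = 1 - s := by
      rw [← Complex.ofReal_mul, Real.mul_self_sqrt (by linarith)]
      push_cast
      rfl
    obtain ⟨g', hi, hj, hn⟩ := exists_rotated_hilbertBasis g hij (α := √(1 - s)) (β := β)
      (by rw [hα, hβ]; ring)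
    have hsym : inner ℂ (g j) (S (g i)) = (starRingEnd ℂ) (inner ℂ (g i) (S (g j))) := by
      rw [inner_conj_symm]
      exact (hS.isSymmetric (g j) (g i)).symm
    rw [map_mul] at hβz
    refine ⟨g', fun n => ?_⟩
    beta_reduce
    by_cases h2 : n = i
    · subst h2
      rw [hi, Equiv.swap_apply_left]
      simp only [map_add, map_smul, inner_add_left, inner_add_right, inner_smul_left,
        inner_smul_right, Complex.conj_ofReal, hsym, ← hg]
      push_cast
      linear_combination -(c n : ℂ) * hα - (c j : ℂ) * hβ - ((√(1 - s) : ℝ) : ℂ) * hβz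
    by_cases h3 : n = j
    · subst h3
      rw [hj, Equiv.swap_apply_right]
      simp only [map_add, map_smul, inner_add_left, inner_add_right, inner_smul_left,
        inner_smul_right, Complex.conj_ofReal, hsym, ← hg, map_neg, Complex.conj_conj]
      push_cast
      linear_combination -(c n : ℂ) * hα - (c i : ℂ) * hβ + ((√(1 - s) : ℝ) : ℂ) * hβz
    · rw [hn n h2 h3, Equiv.swap_apply_of_ne_of_ne h2 h3, ← hg]
      push_cast
      ring

/-! ### Extremal finite sums of sequences and the ℓ¹ norm -/

theorem sum_le_seqU {b : ℕ → ℝ} (hb : Summable b) (F : Finset ℕ) :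
    ∑ i ∈ F, b i ≤ seqU F.card b := by
  refine le_csSup ⟨∑' n, |b n|, ?_⟩ ⟨F, rfl, rfl⟩
  rintro _ ⟨G, _, rfl⟩
  exact (Finset.sum_le_sum fun i _ => le_abs_self _).trans
    (hb.abs.sum_le_tsum G fun i _ => abs_nonneg _)

theorem seqL_le_sum {b : ℕ → ℝ} (hb : Summable b) (F : Finset ℕ) :
    seqL F.card b ≤ ∑ i ∈ F, b i := by
  refine csInf_le ⟨-∑' n, |b n|, ?_⟩ ⟨F, rfl, rfl⟩
  rintro _ ⟨G, _, rfl⟩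
  have h := (Finset.sum_le_sum fun i _ => neg_le_abs (b i)).trans
    (hb.abs.sum_le_tsum G fun i _ => abs_nonneg _)
  rw [Finset.sum_neg_distrib] at h
  exact neg_le.1 h

theorem seqU_le {b : ℕ → ℝ} {k : ℕ} {u : ℝ}
    (h : ∀ F : Finset ℕ, F.card = k → ∑ i ∈ F, b i ≤ u) : seqU k b ≤ u := by
  refine csSup_le ⟨_, Finset.range k, Finset.card_range k, rfl⟩ ?_
  rintro _ ⟨F, hF, rfl⟩
  exact h F hF

theorem le_seqL {b : ℕ → ℝ} {k : ℕ} {u : ℝ}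
    (h : ∀ F : Finset ℕ, F.card = k → u ≤ ∑ i ∈ F, b i) : u ≤ seqL k b := by
  refine le_csInf ⟨_, Finset.range k, Finset.card_range k, rfl⟩ ?_
  rintro _ ⟨F, hF, rfl⟩
  exact h F hF

/-- The positive parts are exactly the terms `b i - t` over the indices with `b i > t`; the
hypothesis is applied to that set, whatever its cardinality. -/
theorem sum_max_sub_le {b : ℕ → ℝ} {t r : ℝ}
    (h : ∀ F : Finset ℕ, ∑ i ∈ F, b i ≤ F.card * t + r) (N : ℕ) :
    ∑ i ∈ Finset.range N, max (b i - t) 0 ≤ r := by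
  set F := (Finset.range N).filter fun i => t < b i
  have h1 : ∑ i ∈ Finset.range N, max (b i - t) 0 = ∑ i ∈ F, (b i - t) := by
    rw [Finset.sum_filter]
    refine Finset.sum_congr rfl fun i _ => ?_
    split_ifs with h
    · exact max_eq_left (by linarith)
    · exact max_eq_right (by linarith)
  rw [h1, Finset.sum_sub_distrib, Finset.sum_const, nsmul_eq_mul]
  linarith [h F]

theorem norm_lp_one (c : lp (fun _ : ℕ => ℂ) 1) : ‖c‖ = ∑' n, ‖c n‖ := by
  rw [lp.norm_eq_tsum_rpow (by simp)]
  simp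

theorem memℓp_one_iff (c : ℕ → ℂ) : Memℓp c 1 ↔ Summable fun n => ‖c n‖ := by
  rw [memℓp_gen_iff (by simp)]
  simp

end SchurHorn

/-! ### The equivalence -/

open SchurHorn in
theorem proposition3p13
    {H : Type*} [NormedAddCommGroup H] [InnerProductSpace ℂ H] [CompleteSpace H]
    (B : HilbertBasis ℕ ℂ H)
    (S : H →L[ℂ] H) (hS : IsSelfAdjoint S) (hS1 : SchurHorn.IsTraceClass S)
    (b : ℕ → ℝ) (hb : Memℓp (fun n => (b n : ℂ)) 1) :
    (⟨fun n => (b n : ℂ), hb⟩ : lp (fun _ : ℕ => ℂ) 1) ∈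
        closure (SchurHorn.orbitDiagonalsL1 B S) ↔
      (∀ k : ℕ, SchurHorn.seqU k b ≤ SchurHorn.opU k S ∧
        SchurHorn.opL k S ≤ SchurHorn.seqL k b) ∧
      ((∑' n, b n : ℝ) : ℂ) = SchurHorn.trace S := by
  obtain ⟨f, a, hf⟩ := exists_diagonalizes B hS hS1
  have hbs : Summable fun n => |b n| := by simpa [memℓp_one_iff] using hb
  have hbsum : Summable b := hbs.of_abs
  constructor
  · intro hcl
    -- Continuity of finite sums makes each inequality a closed condition, so it need only be
    -- checked on actual orbit diagonals.
    have heval : ∀ F : Finset ℕ,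
        Continuous fun c : lp (fun _ : ℕ => ℂ) 1 => (∑ i ∈ F, c i).re := fun F =>
      Complex.continuous_re.comp
        (continuous_finsetSum _ fun i _ => (lp.evalCLM ℂ (fun _ : ℕ => ℂ) 1 i).continuous)
    have hUcl : ∀ F : Finset ℕ, ∑ i ∈ F, b i ≤ opU F.card S := by
      intro F
      have h := closure_minimal (s := orbitDiagonalsL1 B S) (fun c hc => ?_)
        (isClosed_le (heval F) (continuous_const (y := opU F.card S))) hcl
      · simpa using h
      · obtain ⟨g, hg⟩ := (mem_orbitDiagonals_iff B S c).1 hc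
        obtain ⟨P, hP, htr⟩ := hf.exists_projection hS g F
        change (∑ i ∈ F, c i).re ≤ _
        simp_rw [hg]
        rw [← htr]
        exact hf.re_trace_le_opU hS hP
    have hLcl : ∀ F : Finset ℕ, opL F.card S ≤ ∑ i ∈ F, b i := by
      intro F
      have h := closure_minimal (s := orbitDiagonalsL1 B S) (fun c hc => ?_)
        (isClosed_le (continuous_const (y := opL F.card S)) (heval F)) hcl
      · simpa using h
      · obtain ⟨g, hg⟩ := (mem_orbitDiagonals_iff B S c).1 hc
        obtain ⟨P, hP, htr⟩ := hf.exists_projection hS g F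
        change _ ≤ (∑ i ∈ F, c i).re
        simp_rw [hg]
        rw [← htr]
        exact hf.opL_le_re_trace hS hP
    refine ⟨fun k => ⟨seqU_le fun F hF => hF ▸ hUcl F, le_seqL fun F hF => hF ▸ hLcl F⟩, ?_⟩
    have h := closure_minimal (s := orbitDiagonalsL1 B S) (fun c hc => ?_)
      (isClosed_eq (lp.tsumCLM ℂ ℕ ℂ).continuous (continuous_const (y := trace S))) hcl
    · rw [Complex.ofReal_tsum]
      simpa using h
    · obtain ⟨g, hg⟩ := (mem_orbitDiagonals_iff B S c).1 hc
      change ∑' i, c i = trace S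
      simp_rw [hg]
      exact (hf.hasSum_trace hS g).tsum_eq
  · rintro ⟨hUL, htr⟩
    have haC : a ∈ realDiagonals S := ⟨f, fun n => (hf.inner_apply n).symm⟩
    have hsum : ∑' n, b n = ∑' n, a n := by
      have h := (hf.hasSum_trace hS f).tsum_eq
      simp_rw [hf.inner_apply] at h
      rw [← h, ← Complex.ofReal_tsum] at htr
      exact_mod_cast htr
    rw [Metric.mem_closure_iff]
    intro ε hε
    -- The chain is `∑ i ∈ F, b i ≤ U_k(b) ≤ U_k(S) ≤ k t + ∑ (a i - t)⁺` with `k = |F|`, and its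
    -- mirror image for `L_k`. The bound `ε / 2` leaves room for the strict inequality.
    obtain ⟨c, ⟨g, hg⟩, hc⟩ := (isMixingClosed_realDiagonals hS).exists_near haC hf.summable hbsum
      (fun N t ht => sum_max_sub_le (fun F => ((sum_le_seqU hbsum F).trans (hUL _).1).trans
        (hf.opU_le hS _ ht)) N)
      (fun N t ht => sum_max_sub_le (b := fun i => -b i) (fun F => by
        have h := ((hf.le_opL hS F.card ht).trans (hUL _).2).trans (seqL_le_sum hbsum F)
        rw [Finset.sum_neg_distrib]
        linarith) N) hsum (half_pos hε)
    have hdiff : Summable fun n => |c n - b n| := by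
      have h := ENNReal.summable_toReal (hc.trans_lt ENNReal.ofReal_lt_top).ne
      simpa using h
    have hle : ∑' n, |c n - b n| ≤ ε / 2 := by
      simp_rw [Real.enorm_eq_ofReal_abs] at hc
      rw [← ENNReal.ofReal_tsum_of_nonneg (fun n => abs_nonneg _) hdiff] at hc
      exact (ENNReal.ofReal_le_ofReal_iff (by positivity)).1 hc
    have hcs : Summable fun n => |c n| := by
      refine (hdiff.add hbs).of_nonneg_of_le (fun n => abs_nonneg _) fun n => ?_
      simpa using abs_add_le (c n - b n) (b n)
    have hcmem : Memℓp (fun n => (c n : ℂ)) 1 := by simpa [memℓp_one_iff] using hcs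
    refine ⟨⟨fun n => (c n : ℂ), hcmem⟩, (mem_orbitDiagonals_iff B S _).2 ⟨g, hg⟩, ?_⟩
    rw [dist_comm, dist_eq_norm, norm_lp_one]
    refine lt_of_le_of_lt (le_of_eq_of_le (tsum_congr fun n => ?_) hle) (half_lt_self hε)
    change ‖(c n : ℂ) - (b n : ℂ)‖ = _
    rw [← Complex.ofReal_sub, Complex.norm_real, Real.norm_eq_abs]
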